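/- Let $C, R\in\mathbb{Q}$ with $C>0$. For a prime power $q$ and $n\in\mathbb{N}$, let $\Lambda(n,q)$, $\mathrm{M}(n,q)$ and $\mathrm{S}(n,q)$ denote the $\mathbb{F}_q$-vector spaces of alternating (that is, $v^{\mathsf T}Av=0$ for all $v\in\mathbb{F}_q^n$), of all, and of symmetric $n\times n$ matrices over $\mathbb{F}_q$, respectively. For a linear subspace $\mathcal{A}$ of $\mathrm{M}(n,q)$ let $$\mathrm{Aut}(\mathcal{A})=\{P\in\mathrm{GL}(n,q)\mid P^{\mathsf T}\mathcal{A}P=\mathcal{A}\},\qquad P^{\mathsf T}\mathcal{A}P=\{P^{\mathsf T}AP\mid A\in\mathcal{A}\}.$$ Then there exist a real number $\varepsilon>0$ and an integer $n_0$, both depending only on $C$ and $R$, such that the following holds for all prime powers $q$ and all $n\ge n_0$. Put $m=\lceil Cn+R\rceil$ (whenever this is non-negative) and $K=q^{m^2}/|\mathrm{GL}(m,q)|$. For each $U\in\{\Lambda(n,q),\mathrm{M}(n,q),\mathrm{S}(n,q)\}$, the space $U$ has $m$-dimensional subspaces, and the fraction of the $m$-dimensional subspaces $\mathcal{A}$ of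 $U$ with $|\mathrm{Aut}(\mathcal{A})|>K\cdot(q-1)$ is at most $q^{-\varepsilon n^2}$. -/

import Mathlib

open scoped Matrix

namespace MatSpace

/-- The space `M(n, q)` of all `n × n` matrices. -/
def general (F : Type*) [Field F] (n : ℕ) : Submodule F (Matrix (Fin n) (Fin n) F) := ⊤

/-- The space `S(n, q)` of symmetric `n × n` matrices. -/
def symmetric (F : Type*) [Field F] (n : ℕ) : Submodule F (Matrix (Fin n) (Fin n) F) where
  carrier := {A | A.IsSymm}
  add_mem' := fun hA hB => Matrix.IsSymm.add hA hB
  zero_mem' := Matrix.isSymm_zero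
  smul_mem' := fun c _ hA => Matrix.IsSymm.smul hA c

/-- The space `Λ(n, q)` of alternating `n × n` matrices: those with `vᵀ A v = 0` for every vector
`v` (in every characteristic: skew-symmetric with zero diagonal). -/
def alternating (F : Type*) [Field F] (n : ℕ) : Submodule F (Matrix (Fin n) (Fin n) F) where
  carrier := {A | ∀ v : Fin n → F, v ⬝ᵥ (A *ᵥ v) = 0}
  add_mem' := by
    intro A B hA hB v
    rw [Matrix.add_mulVec, dotProduct_add, hA v, hB v, add_zero]
  zero_mem' := by
    intro v
    rw [Matrix.zero_mulVec, dotProduct_zero]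
  smul_mem' := by
    intro c A hA v
    rw [Matrix.smul_mulVec, dotProduct_smul, hA v, smul_zero]

/-- `Gr(U, m)`: the set of `m`-dimensional subspaces of the subspace `U`. -/
def Gr {F E : Type*} [Field F] [AddCommGroup E] [Module F E] (U : Submodule F E) (m : ℕ) :
    Set (Submodule F E) :=
  {A | A ≤ U ∧ Module.finrank F A = m}

/-- The congruence map `A ↦ Pᵀ A P`. -/
def congr {F : Type*} [Field F] {n : ℕ} (P : Matrix (Fin n) (Fin n) F) :
    Matrix (Fin n) (Fin n) F →ₗ[F] Matrix (Fin n) (Fin n) F where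
  toFun A := Pᵀ * A * P
  map_add' A B := by rw [Matrix.mul_add, Matrix.add_mul]
  map_smul' c A := by rw [Matrix.mul_smul, Matrix.smul_mul, RingHom.id_apply]

theorem congr_one {F : Type*} [Field F] {n : ℕ} :
    congr (1 : Matrix (Fin n) (Fin n) F) = LinearMap.id := by
  ext1 A
  simp [congr]

theorem congr_mul {F : Type*} [Field F] {n : ℕ} (P Q : Matrix (Fin n) (Fin n) F) :
    congr (P * Q) = congr Q ∘ₗ congr P := by
  refine LinearMap.ext fun A => ?_
  simp [congr, Matrix.transpose_mul, Matrix.mul_assoc]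

/-- `Aut(𝒜) = {P ∈ GL(n, q) | Pᵀ 𝒜 P = 𝒜}`. -/
def Aut {F : Type*} [Field F] {n : ℕ} (A : Submodule F (Matrix (Fin n) (Fin n) F)) :
    Subgroup (GL (Fin n) F) where
  carrier := {P | A.map (congr (P : Matrix (Fin n) (Fin n) F)) = A}
  one_mem' := by
    simp only [Set.mem_setOf_eq, Units.val_one, congr_one, Submodule.map_id]
  mul_mem' := by
    intro P Q hP hQ
    simp only [Set.mem_setOf_eq] at hP hQ ⊢
    rw [Units.val_mul, congr_mul, Submodule.map_comp, hP, hQ]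
  inv_mem' := by
    intro P hP
    simp only [Set.mem_setOf_eq] at hP ⊢
    conv_lhs => rw [← hP]
    rw [← Submodule.map_comp, ← congr_mul, Units.mul_inv, congr_one, Submodule.map_id]

/-- `K = q^{m²} / |GL(m, q)|`, where `q = |F|`. -/
noncomputable def K (F : Type*) [Field F] (m : ℕ) : ℝ :=
  (Nat.card F : ℝ) ^ (m ^ 2) / (Nat.card (GL (Fin m) F) : ℝ)

/-- The `m`-dimensional subspaces `𝒜` of `U` whose automorphism group has order greater than
`K · (q - 1)`. -/
noncomputable def exceptional {F : Type*} [Field F] {n : ℕ}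
    (U : Submodule F (Matrix (Fin n) (Fin n) F)) (m : ℕ) :
    Set (Submodule F (Matrix (Fin n) (Fin n) F)) :=
  {A | A ∈ Gr U m ∧ K F m * ((Nat.card F : ℝ) - 1) < (Nat.card (Aut A) : ℝ)}

/-- There are `m`-dimensional subspaces of `U`, and all but a `δ` fraction of them have
automorphism group of order at most `K · (q - 1)`. -/
def AllButFraction {F : Type*} [Field F] {n : ℕ}
    (U : Submodule F (Matrix (Fin n) (Fin n) F)) (m : ℕ) (δ : ℝ) : Prop :=
  (Gr U m).Nonempty ∧
    ((exceptional U m).ncard : ℝ) / ((Gr U m).ncard : ℝ) ≤ δ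

end MatSpace

/-! Since K ≥ 1 and there are only q − 1 invertible scalar matrices, an exceptional 𝒜 is preserved
by a nonscalar P. So it suffices to bound, over all nonscalar P, the number of m-dimensional
subspaces of U invariant under T : A ↦ PᵀAP, and to compare the sum with the total, at least |U|^m /
(q^m · `frames F m`).

The main tool is a dichotomy, `exists_jointlyIndep_or`: an endomorphism either has s vectors that
are linearly independent together with their images, or equals a scalar modulo a subspace of
dimension at most 2s. It is used twice, for P on F^n with a constant t, and for T on an invariant 𝒜
with s about m/4.

If P has t jointly independent vectors, every eigenspace of T has codimension at least t(n − 2t) in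
U (`Admissible.card_eigenspace_mul_le`). The dichotomy on 𝒜 then yields either m − 2s generators in
one eigenspace or s generators that come for free as images of others (`ncard_invariant_le`). For t
large both savings beat the at most q^(n²) choices of P.

Otherwise P = c + XY with rank at most 2t, which leaves only q^(1 + 4tn) matrices. Now D = T − c²
has a small range, and an invariant 𝒜 either lies in ker D, of codimension at least n − 2, or
contains a nonzero vector of range D. Both events are rare enough. -/

namespace MatSpace

open Module

/-! ### Linear algebra: jointly independent families and near-scalar endomorphisms -/

section Vectors

variable {F V : Type*} [Field F] [AddCommGroup V] [Module F V]

/-- The vectors `x i` together with their images `T (x i)` are linearly independent. -/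
def JointlyIndep (T : V →ₗ[F] V) {s : ℕ} (x : Fin s → V) : Prop :=
  ∀ a b : Fin s → F, ∑ i, a i • x i + ∑ i, b i • T (x i) = 0 → a = 0 ∧ b = 0

/-- An endomorphism mapping every vector into its own line modulo `W` is a scalar modulo `W`, as
soon as `W` has codimension at least two. -/
theorem exists_forall_sub_smul_mem [FiniteDimensional F V] (T : V →ₗ[F] V) (W : Submodule F V)
    (hW : 2 ≤ finrank F (V ⧸ W))
    (H : ∀ y, ∃ a b : F, (a ≠ 0 ∨ b ≠ 0) ∧ a • y + b • T y ∈ W) :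
    ∃ c : F, ∀ y, T y - c • y ∈ W := by
  have key : ∀ y, y ∉ W → ∃ c : F, T y - c • y ∈ W := by
    intro y hy
    obtain ⟨a, b, hab, h⟩ := H y
    have hb : b ≠ 0 := by
      rintro rfl
      have ha : a ≠ 0 := by simpa using hab
      rw [zero_smul, add_zero] at h
      exact hy ((W.smul_mem_iff ha).1 h)
    refine ⟨-(b⁻¹ * a), ?_⟩
    have := W.smul_mem b⁻¹ h
    rw [smul_add, smul_smul, smul_smul, inv_mul_cancel₀ hb, one_smul] at this
    convert this using 1
    module
  -- For w in W and y outside W, comparing y with y + w puts T w on the line of y modulo W. Two such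
  -- lines that are independent meet only in 0; this is where codimension two is needed.
  have hTW : W ≤ W.comap T := by
    intro w hw
    obtain ⟨v, hv⟩ := exists_linearIndependent_of_le_finrank hW
    obtain ⟨y, hy⟩ : ∃ y : Fin 2 → V, ∀ i, W.mkQ (y i) = v i :=
      ⟨fun i => (W.mkQ_surjective (v i)).choose, fun i => (W.mkQ_surjective (v i)).choose_spec⟩
    have hyW : ∀ i, y i ∉ W := by
      intro i hi
      apply hv.ne_zero i
      rw [← hy]
      simpa using hi
    have hline : ∀ i, ∃ d : F, W.mkQ (T w) = d • v i := by
      intro i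
      obtain ⟨c, hc⟩ := key _ (hyW i)
      obtain ⟨c', hc'⟩ := key (y i + w) (fun h => hyW i ((W.add_mem_iff_left hw).1 h))
      refine ⟨c' - c, ?_⟩
      rw [← hy, ← map_smul, ← sub_eq_zero, ← map_sub]
      have : T w - (c' - c) • y i ∈ W := by
        have := W.sub_mem (W.add_mem hc' (W.smul_mem c' hw)) hc
        rw [map_add] at this
        convert this using 1
        module
      exact (Submodule.Quotient.mk_eq_zero W).2 this
    obtain ⟨d₀, h₀⟩ := hline 0
    obtain ⟨d₁, h₁⟩ := hline 1
    have hv' : LinearIndependent F ![v 0, v 1] := by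
      convert hv using 1
      ext i
      fin_cases i <;> rfl
    have := (LinearIndependent.pair_iff.1 hv') d₀ (-d₁) (by
      rw [neg_smul, ← h₀, ← h₁, add_neg_cancel])
    rw [this.1, zero_smul] at h₀
    simpa using h₀
  obtain ⟨c, hc⟩ := LinearMap.exists_eq_smul_id_of_forall_notLinearIndependent
    (f := W.mapQ W T hTW) (by
      intro v hv
      obtain ⟨y, rfl⟩ := W.mkQ_surjective v
      obtain ⟨a, b, hab, h⟩ := H y
      have := LinearIndependent.pair_iff.1 hv a b (by
        have : W.mkQ (a • y + b • T y) = 0 := (Submodule.Quotient.mk_eq_zero W).2 h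
        rwa [map_add, map_smul, map_smul] at this)
      rcases hab with h | h
      · exact h this.1
      · exact h this.2)
  refine ⟨c, fun y => ?_⟩
  have := LinearMap.congr_fun hc (W.mkQ y)
  have h2 : W.mkQ (T y - c • y) = 0 := by
    rw [map_sub, map_smul, sub_eq_zero]
    simpa using this
  exact (Submodule.Quotient.mk_eq_zero W).1 h2

/-- Either `s` vectors are linearly independent together with their images, or `T` differs from a
scalar by a map of rank at most `2 * s`. -/
theorem exists_jointlyIndep_or [FiniteDimensional F V] (T : V →ₗ[F] V) (s : ℕ)
    (hs : 2 * s ≤ finrank F V) :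
    (∃ x : Fin s → V, JointlyIndep T x) ∨
      ∃ c : F, ∃ W : Submodule F V, finrank F W ≤ 2 * s ∧ ∀ y, T y - c • y ∈ W := by
  induction s with
  | zero => exact Or.inl ⟨Fin.elim0, fun a b _ => ⟨Subsingleton.elim _ _, Subsingleton.elim _ _⟩⟩
  | succ s ih =>
    rcases ih (by omega) with ⟨x, hx⟩ | ⟨c, W, hW, h⟩
    · by_cases hex : ∃ y : Fin (s + 1) → V, JointlyIndep T y
      · exact Or.inl hex
      right
      -- No y extends the family x, so each y has a relation with T y modulo this span, which has
      -- codimension at least 2.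
      set W : Submodule F V := Submodule.span F (Set.range (Sum.elim x (fun i => T (x i))))
      have hx1 : ∀ i, x i ∈ W := fun i => Submodule.subset_span ⟨Sum.inl i, rfl⟩
      have hx2 : ∀ i, T (x i) ∈ W := fun i => Submodule.subset_span ⟨Sum.inr i, rfl⟩
      have hWr : finrank F W ≤ 2 * s := by
        have := finrank_range_le_card (R := F) (Sum.elim x (fun i => T (x i)))
        simp only [Fintype.card_sum, Fintype.card_fin] at this
        exact this.trans (by omega)
      have hQ := W.finrank_quotient_add_finrank
      obtain ⟨c, hc⟩ := exists_forall_sub_smul_mem T W (by omega) (by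
        intro y
        by_contra! hcon
        refine hex ⟨Fin.cons y x, fun a b hab => ?_⟩
        simp only [Fin.sum_univ_succ, Fin.cons_zero, Fin.cons_succ] at hab
        have hmem : a 0 • y + b 0 • T y ∈ W := by
          have h1 : ∑ i : Fin s, a i.succ • x i ∈ W :=
            W.sum_mem fun i _ => W.smul_mem _ (hx1 i)
          have h2 : ∑ i : Fin s, b i.succ • T (x i) ∈ W :=
            W.sum_mem fun i _ => W.smul_mem _ (hx2 i)
          rw [show a 0 • y + b 0 • T y = -(∑ i : Fin s, a i.succ • x i +
            ∑ i : Fin s, b i.succ • T (x i)) by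
              rw [eq_neg_iff_add_eq_zero, ← hab]; abel]
          exact W.neg_mem (W.add_mem h1 h2)
        have h0 : a 0 = 0 ∧ b 0 = 0 := by
          by_contra h
          rw [not_and_or] at h
          exact hcon _ _ h hmem
        rw [h0.1, h0.2, zero_smul, zero_smul, zero_add, zero_add] at hab
        obtain ⟨ha, hb⟩ := hx _ _ hab
        constructor
        · ext i
          refine Fin.cases h0.1 (fun j => congrFun ha j) i
        · ext i
          refine Fin.cases h0.2 (fun j => congrFun hb j) i)
      exact ⟨c, W, by omega, hc⟩
    · exact Or.inr ⟨c, W, by omega, h⟩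

/-- A subspace of codimension at most `r` in `A` is completed to `A` by `r` vectors. -/
theorem exists_sup_span_range_eq [FiniteDimensional F V] (r : ℕ) (B A : Submodule F V)
    (hBA : B ≤ A) (h : finrank F A ≤ finrank F B + r) :
    ∃ z : Fin r → V, B ⊔ Submodule.span F (Set.range z) = A := by
  induction r generalizing B with
  | zero =>
    refine ⟨Fin.elim0, ?_⟩
    rw [Submodule.eq_of_le_of_finrank_le hBA h]
    simp
  | succ r ih =>
    rcases eq_or_lt_of_le hBA with rfl | hlt
    · refine ⟨fun _ => 0, ?_⟩
      rw [sup_eq_left, Submodule.span_le]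
      rintro _ ⟨i, rfl⟩
      exact B.zero_mem
    · obtain ⟨v, hvA, hvB⟩ := SetLike.exists_of_lt hlt
      have hlt' : B < B ⊔ Submodule.span F {v} := by
        refine lt_of_le_of_ne le_sup_left fun h => hvB ?_
        rw [h]
        exact Submodule.mem_sup_right (Submodule.mem_span_singleton_self v)
      have := Submodule.finrank_lt_finrank_of_lt hlt'
      obtain ⟨z, hz⟩ := ih (B ⊔ Submodule.span F {v})
        (sup_le hBA (by simpa using hvA)) (by omega)
      refine ⟨Fin.cons v z, ?_⟩
      rw [Fin.range_cons, Set.insert_eq, Submodule.span_union, ← sup_assoc, hz]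

end Vectors

/-! ### Counting subspaces, in particular invariant ones -/

section Counting

/-- The number of ordered bases of an `m`-dimensional space. -/
noncomputable def frames (F : Type*) [Field F] (m : ℕ) : ℕ :=
  Nat.card {y : Fin m → (Fin m → F) // LinearIndependent F y}

theorem frames_le (F : Type*) [Field F] [Finite F] (m : ℕ) :
    frames F m ≤ Nat.card F ^ (m ^ 2) := by
  refine (Finite.card_subtype_le _).trans ?_
  simp [Nat.card_fun, ← pow_mul, sq]

theorem frames_pos (F : Type*) [Field F] [Finite F] (m : ℕ) : 0 < frames F m := by
  have : Nonempty {y : Fin m → (Fin m → F) // LinearIndependent F y} :=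
    ⟨⟨Pi.basisFun F (Fin m), (Pi.basisFun F (Fin m)).linearIndependent⟩⟩
  exact Nat.card_pos

variable {F V : Type*} [Field F] [AddCommGroup V] [Module F V] [Finite V]

/-- Counting subspaces by their ordered bases. -/
theorem ncard_mul_frames_le {m : ℕ} (S : Set (Submodule F V)) (hS : ∀ A ∈ S, finrank F A = m)
    (X : Set (Fin m → V))
    (h : ∀ x, LinearIndependent F x → Submodule.span F (Set.range x) ∈ S → x ∈ X) :
    S.ncard * frames F m ≤ X.ncard := by
  have φ : ∀ A : S, Nonempty ((Fin m → F) ≃ₗ[F] A.1) := fun A =>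
    FiniteDimensional.nonempty_linearEquiv_of_finrank_eq (by simp [hS A.1 A.2])
  rw [← Nat.card_coe_set_eq, ← Nat.card_coe_set_eq, frames, ← Nat.card_prod]
  -- Transport the frames of F^m to each A along a chosen isomorphism; the span of the resulting
  -- tuple recovers A.
  let g : S × {y : Fin m → (Fin m → F) // LinearIndependent F y} → Fin m → V :=
    fun p i => ((φ p.1).some (p.2.1 i) : V)
  have hli : ∀ p, LinearIndependent F (g p) := fun p =>
    p.2.2.map' (p.1.1.subtype ∘ₗ (φ p.1).some.toLinearMap)
      (LinearMap.ker_eq_bot.2 (Subtype.val_injective.comp (φ p.1).some.injective))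
  have hspan : ∀ p, Submodule.span F (Set.range (g p)) = p.1.1 := by
    intro p
    refine Submodule.eq_of_le_of_finrank_le ?_ ?_
    · rw [Submodule.span_le]
      rintro _ ⟨i, rfl⟩
      exact ((φ p.1).some (p.2.1 i)).2
    · rw [finrank_span_eq_card (hli p), Fintype.card_fin, hS _ p.1.2]
  refine Nat.card_le_card_of_injective
    (fun p => (⟨g p, h _ (hli p) (by rw [hspan]; exact p.1.2)⟩ : X)) ?_
  intro p p' hpp
  have hg : g p = g p' := congrArg Subtype.val hpp
  have h1 : p.1 = p'.1 := Subtype.ext (by rw [← hspan p, ← hspan p', hg])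
  obtain ⟨A, y⟩ := p
  obtain ⟨A', y'⟩ := p'
  obtain rfl : A = A' := h1
  congr 1
  refine Subtype.ext (funext fun i => ?_)
  exact (φ A).some.injective (Subtype.ext (congrFun hg i))

/-- Almost all m-tuples are independent; the crude loss of one factor q per vector is enough here.
-/
theorem card_pow_le_mul_frames [Finite F] {m : ℕ} (hm : m ≤ finrank F V) :
    Nat.card V ^ m ≤
      Nat.card F ^ m * ({A : Submodule F V | finrank F A = m}.ncard * frames F m) := by
  have h1 : Nat.card {x : Fin m → V // LinearIndependent F x} ≤
      {A : Submodule F V | finrank F A = m}.ncard * frames F m := by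
    rw [← Nat.card_coe_set_eq, frames, ← Nat.card_prod]
    have φ : ∀ A : {A : Submodule F V | finrank F A = m}, Nonempty ((Fin m → F) ≃ₗ[F] A.1) :=
      fun A => FiniteDimensional.nonempty_linearEquiv_of_finrank_eq (by
        rw [finrank_fin_fun]; exact A.2.symm)
    refine Nat.card_le_card_of_surjective
      (fun p => ⟨fun i => ((φ p.1).some (p.2.1 i) : V), p.2.2.map'
        (p.1.1.subtype ∘ₗ (φ p.1).some.toLinearMap)
        (LinearMap.ker_eq_bot.2 (Subtype.val_injective.comp (φ p.1).some.injective))⟩) ?_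
    rintro ⟨x, hx⟩
    let A : {A : Submodule F V | finrank F A = m} :=
      ⟨Submodule.span F (Set.range x), by
        change finrank F (Submodule.span F (Set.range x)) = m
        rw [finrank_span_eq_card hx, Fintype.card_fin]⟩
    refine ⟨⟨A, ⟨fun i => (φ A).some.symm ⟨x i, Submodule.subset_span ⟨i, rfl⟩⟩, ?_⟩⟩, ?_⟩
    · exact (linearIndependent_span hx).map' (φ A).some.symm.toLinearMap
        (LinearMap.ker_eq_bot.2 (φ A).some.symm.injective)
    · refine Subtype.ext (funext fun i => ?_)
      simp
  refine le_trans ?_ (Nat.mul_le_mul_left _ h1)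
  have := Fintype.ofFinite F
  rw [card_linearIndependent hm, Module.natCard_eq_pow_finrank (K := F) (V := V),
    ← Nat.card_eq_fintype_card]
  have hq : 1 < Nat.card F := Finite.one_lt_card
  have hprod : (Nat.card F ^ finrank F V) ^ m = ∏ _i : Fin m, Nat.card F ^ finrank F V := by simp
  have hprod' : Nat.card F ^ m = ∏ _i : Fin m, Nat.card F := by simp
  rw [hprod, hprod', ← Finset.prod_mul_distrib]
  -- With d = dim V > i and q ≥ 2, each factor satisfies q^d ≤ q(q^d − q^i).
  refine Finset.prod_le_prod' fun i _ => ?_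
  obtain ⟨N, hN⟩ : ∃ N, finrank F V = N + 1 :=
    ⟨finrank F V - 1, by have := i.2; omega⟩
  have h2 : Nat.card F ^ (i : ℕ) ≤ Nat.card F ^ N := Nat.pow_le_pow_right (by omega) (by have := i.2; omega)
  rw [hN, pow_succ']
  refine Nat.mul_le_mul_left _ ?_
  have h3 : 2 * Nat.card F ^ N ≤ Nat.card F * Nat.card F ^ N := Nat.mul_le_mul_right _ hq
  omega

/-- A subspace invariant under `T` either contains many eigenvectors or has few generators. -/
theorem invariant_cases (T : V →ₗ[F] V) {m s : ℕ} (hs : 2 * s ≤ m) (A : Submodule F V)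
    (hA : finrank F A = m) (hT : A ≤ A.comap T) :
    (∃ c : F, ∃ y : Fin (m - 2 * s) → LinearMap.ker (T - c • LinearMap.id),
      ∃ z : Fin (2 * s) → V,
        Submodule.span F (Set.range fun i => (y i : V)) ⊔ Submodule.span F (Set.range z) = A) ∨
    ∃ x : Fin s → V, ∃ z : Fin (m - 2 * s) → V,
      Submodule.span F (Set.range (Sum.elim x fun i => T (x i))) ⊔
        Submodule.span F (Set.range z) = A := by
  have hTA : ∀ v ∈ A, T v ∈ A := hT
  rcases exists_jointlyIndep_or (T.restrict hTA) s (by omega) with ⟨x, hx⟩ | ⟨c, W, hW, hc⟩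
  · right
    refine ⟨fun i => x i, ?_⟩
    apply exists_sup_span_range_eq
    · rw [Submodule.span_le]
      rintro _ ⟨i | i, rfl⟩
      · exact (x i).2
      · exact hTA _ (x i).2
    · have hli : LinearIndependent F
          (Sum.elim (fun i => (x i : V)) fun i => T (x i : V)) := by
        rw [Fintype.linearIndependent_iff]
        intro g hg
        rw [Fintype.sum_sum_type] at hg
        have := hx (fun i => g (Sum.inl i)) (fun i => g (Sum.inr i)) (by
          apply Subtype.ext
          simpa using hg)
        rintro (i | i)
        · exact congrFun this.1 i
        · exact congrFun this.2 i
      rw [finrank_span_eq_card hli, Fintype.card_sum, Fintype.card_fin]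
      omega
  · left
    refine ⟨c, ?_⟩
    set f : A →ₗ[F] A := T.restrict hTA - c • LinearMap.id
    -- The range lies in W, so the eigenspace of T on A has dimension at least m − 2s.
    have hr : finrank F (LinearMap.range f) ≤ 2 * s := by
      refine (Submodule.finrank_mono ?_).trans hW
      rintro _ ⟨y, rfl⟩
      exact hc y
    have hrk := f.finrank_range_add_finrank_ker
    obtain ⟨y, hy⟩ := exists_linearIndependent_of_le_finrank
      (R := F) (M := LinearMap.ker f) (n := m - 2 * s) (by omega)
    have hli : LinearIndependent F (fun i => ((y i : A) : V)) :=
      hy.map' (A.subtype ∘ₗ (LinearMap.ker f).subtype)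
        (LinearMap.ker_eq_bot.2 (Subtype.val_injective.comp Subtype.val_injective))
    refine ⟨fun i => ⟨((y i : A) : V), ?_⟩, ?_⟩
    · have := congrArg Subtype.val (LinearMap.mem_ker.1 (y i).2)
      exact LinearMap.mem_ker.2 this
    · apply exists_sup_span_range_eq
      · rw [Submodule.span_le]
        rintro _ ⟨i, rfl⟩
        exact (y i : A).2
      · rw [finrank_span_eq_card hli, Fintype.card_fin]
        omega

/-- The two terms are the two cases of `invariant_cases`. Eigenvectors save q^k for each of m − 2s
generators, after q choices of eigenvalue; in the other case s generators are determined by the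
rest. Generating tuples are not divided by the number of bases, a loss of about q^(m²) that is paid
for later. -/
theorem ncard_invariant_le [Finite F] (T : V →ₗ[F] V) {m s k : ℕ} (hs : 2 * s ≤ m)
    (hE : ∀ c : F, Nat.card (LinearMap.ker (T - c • LinearMap.id)) * Nat.card F ^ k ≤ Nat.card V) :
    {A : Submodule F V | finrank F A = m ∧ A ≤ A.comap T}.ncard * Nat.card F ^ ((m - 2 * s) * k) ≤
      Nat.card F * Nat.card V ^ m +
        Nat.card V ^ (m - s) * Nat.card F ^ ((m - 2 * s) * k) := by
  have := Fintype.ofFinite F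
  let E : F → Submodule F V := fun c => LinearMap.ker (T - c • LinearMap.id)
  let f : (Σ c : F, (Fin (m - 2 * s) → E c) × (Fin (2 * s) → V)) → Submodule F V := fun p =>
    Submodule.span F (Set.range fun i => (p.2.1 i : V)) ⊔ Submodule.span F (Set.range p.2.2)
  let g : (Fin s → V) × (Fin (m - 2 * s) → V) → Submodule F V := fun p =>
    Submodule.span F (Set.range (Sum.elim p.1 fun i => T (p.1 i))) ⊔
        Submodule.span F (Set.range p.2)
  have hsub : {A : Submodule F V | finrank F A = m ∧ A ≤ A.comap T} ⊆
      Set.range f ∪ Set.range g := by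
    rintro A ⟨hA, hT⟩
    rcases invariant_cases T hs A hA hT with ⟨c, y, z, h⟩ | ⟨x, z, h⟩
    · exact Or.inl ⟨⟨c, y, z⟩, h⟩
    · exact Or.inr ⟨⟨x, z⟩, h⟩
  have hf : (Set.range f).ncard ≤
      ∑ c : F, Nat.card (E c) ^ (m - 2 * s) * Nat.card V ^ (2 * s) := by
    rw [← Nat.card_coe_set_eq]
    refine (Finite.card_range_le f).trans ?_
    simp [Nat.card_sigma, Nat.card_prod, Nat.card_fun]
  have hg : (Set.range g).ncard ≤ Nat.card V ^ (m - s) := by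
    rw [← Nat.card_coe_set_eq]
    refine (Finite.card_range_le g).trans ?_
    rw [Nat.card_prod, Nat.card_fun, Nat.card_fun, ← pow_add]
    simp only [Nat.card_eq_fintype_card, Fintype.card_fin]
    rw [show s + (m - 2 * s) = m - s by omega]
  have hf' : (∑ c : F, Nat.card (E c) ^ (m - 2 * s) * Nat.card V ^ (2 * s)) *
      Nat.card F ^ ((m - 2 * s) * k) ≤ Nat.card F * Nat.card V ^ m := by
    rw [Finset.sum_mul]
    refine (Finset.sum_le_card_nsmul _ _ (Nat.card V ^ m) fun c _ => ?_).trans ?_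
    · calc _ = (Nat.card (E c) * Nat.card F ^ k) ^ (m - 2 * s) * Nat.card V ^ (2 * s) := by
            rw [mul_pow, ← pow_mul, mul_comm k]; ring
        _ ≤ Nat.card V ^ (m - 2 * s) * Nat.card V ^ (2 * s) :=
            Nat.mul_le_mul_right _ (Nat.pow_le_pow_left (hE c) _)
        _ = _ := by rw [← pow_add]; congr 1; omega
    · simp [Nat.card_eq_fintype_card]
  calc _ ≤ ((Set.range f).ncard + (Set.range g).ncard) * Nat.card F ^ ((m - 2 * s) * k) :=
        Nat.mul_le_mul_right _
          ((Set.ncard_le_ncard hsub (Set.toFinite _)).trans (Set.ncard_union_le _ _))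
    _ = (Set.range f).ncard * Nat.card F ^ ((m - 2 * s) * k) +
        (Set.range g).ncard * Nat.card F ^ ((m - 2 * s) * k) := add_mul _ _ _
    _ ≤ _ := Nat.add_le_add ((Nat.mul_le_mul_right _ hf).trans hf') (Nat.mul_le_mul_right _ hg)

/-- Subspaces of a subspace `E`. -/
theorem ncard_le_submodule_mul_frames_le [Finite F] (E : Submodule F V) (m : ℕ) :
    {A : Submodule F V | finrank F A = m ∧ A ≤ E}.ncard * frames F m ≤ Nat.card E ^ m := by
  refine (ncard_mul_frames_le _ (fun A hA => hA.1) (Set.range fun (y : Fin m → E) i => (y i : V))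
    fun x _ hx => ⟨fun i => ⟨x i, hx.2 (Submodule.subset_span ⟨i, rfl⟩)⟩, rfl⟩).trans ?_
  rw [← Nat.card_coe_set_eq]
  refine (Finite.card_range_le _).trans ?_
  simp [Nat.card_fun]

/-- Subspaces through a nonzero vector `v`. -/
theorem ncard_mem_mul_frames_le [Finite F] (v : V) (hv : v ≠ 0) (m : ℕ) :
    {A : Submodule F V | finrank F A = m ∧ v ∈ A}.ncard * frames F m * Nat.card V ≤
      Nat.card F ^ m * Nat.card V ^ m := by
  have := Fintype.ofFinite F
  -- Sort the bases by the coordinates a of v. Moving a component x_j with a_j ≠ 0 moves the sum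
  -- freely, so each class is a 1/|V| fraction of all tuples at most.
  let X : (Fin m → F) → Set (Fin m → V) := fun a => {x | ∑ i, a i • x i = v}
  have hX : ∀ a, (X a).ncard * Nat.card V ≤ Nat.card V ^ m := by
    intro a
    rcases (X a).eq_empty_or_nonempty with h | ⟨x₀, hx₀⟩
    · simp [h]
    · obtain ⟨j, hj⟩ : ∃ j, a j ≠ 0 := by
        by_contra! h
        exact hv (by rw [← hx₀]; simp [h])
      rw [← Nat.card_coe_set_eq, ← Nat.card_prod]
      refine (Nat.card_le_card_of_injective
        (fun p : X a × V => p.1.1 + Pi.single j p.2) ?_).trans (by simp [Nat.card_fun])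
      intro p p' h
      have hsum : ∀ p : X a × V, ∑ i, a i • (p.1.1 + Pi.single j p.2 : Fin m → V) i = v + a j • p.2 := by
        intro p
        simp only [Pi.add_apply, smul_add, Finset.sum_add_distrib]
        congr 1
        · exact p.1.2
        · simp [Pi.single_apply]
      have h2 : p.2 = p'.2 := by
        have := hsum p
        rw [show p.1.1 + Pi.single j p.2 = p'.1.1 + Pi.single j p'.2 from h, hsum p'] at this
        exact (smul_right_injective V hj (add_left_cancel this)).symm
      refine Prod.ext (Subtype.ext ?_) h2
      have h' : p.1.1 + Pi.single j p.2 = p'.1.1 + Pi.single j p'.2 := h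
      rw [h2] at h'
      exact add_right_cancel h'
  have h1 := ncard_mul_frames_le {A : Submodule F V | finrank F A = m ∧ v ∈ A}
    (fun A hA => hA.1) (⋃ a, X a) (fun x _ hx => by
      obtain ⟨a, ha⟩ := (Submodule.mem_span_range_iff_exists_fun F).1 hx.2
      exact Set.mem_iUnion.2 ⟨a, ha⟩)
  calc _ ≤ (∑ a, (X a).ncard) * Nat.card V :=
        Nat.mul_le_mul_right _ (h1.trans (Set.ncard_iUnion_le_of_fintype _))
    _ = ∑ a, (X a).ncard * Nat.card V := Finset.sum_mul _ _ _
    _ ≤ ∑ _a : Fin m → F, Nat.card V ^ m := Finset.sum_le_sum fun a _ => hX a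
    _ = _ := by simp [Nat.card_eq_fintype_card]

end Counting

/-! ### Congruence on the three matrix spaces: eigenspaces and low-rank perturbations -/

section Congruence

variable {F : Type*} [Field F] {n : ℕ}

/-- The properties of the three matrix spaces on which the counting relies. -/
structure Admissible (U : Submodule F (Matrix (Fin n) (Fin n) F)) : Prop where
  congr_mem : ∀ P, ∀ A ∈ U, congr P A ∈ U
  -- The sign is 0, 1, −1 for all, symmetric and alternating matrices; it supplies enough low-rank
  -- elements of U in every characteristic.
  exists_sign : ∃ σ : F, ∀ v a : Fin n → F,
    Matrix.vecMulVec v a + σ • Matrix.vecMulVec a v ∈ U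

theorem admissible_general : Admissible (general F n) where
  congr_mem _ _ _ := Submodule.mem_top
  exists_sign := ⟨0, fun _ _ => Submodule.mem_top⟩

theorem admissible_symmetric : Admissible (symmetric F n) where
  congr_mem P A hA := by
    change (Pᵀ * A * P).IsSymm
    have hA' : Aᵀ = A := hA
    simp [Matrix.IsSymm, Matrix.transpose_mul, hA', Matrix.mul_assoc]
  exists_sign := by
    refine ⟨1, fun v a => ?_⟩
    change (Matrix.vecMulVec v a + (1 : F) • Matrix.vecMulVec a v).IsSymm
    rw [one_smul, Matrix.IsSymm, Matrix.transpose_add, Matrix.transpose_vecMulVec,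
      Matrix.transpose_vecMulVec, add_comm]

theorem admissible_alternating : Admissible (alternating F n) where
  congr_mem P A hA v := by
    have := hA (P *ᵥ v)
    change v ⬝ᵥ ((Pᵀ * A * P) *ᵥ v) = 0
    rwa [← Matrix.mulVec_mulVec, ← Matrix.mulVec_mulVec, Matrix.mulVec_transpose,
      dotProduct_comm, ← Matrix.dotProduct_mulVec, dotProduct_comm]
  exists_sign := by
    refine ⟨-1, fun v a w => ?_⟩
    rw [neg_one_smul, Matrix.add_mulVec, Matrix.neg_mulVec, Matrix.vecMulVec_mulVec,
      Matrix.vecMulVec_mulVec]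
    simp [dotProduct_comm w, mul_comm]

variable {U : Submodule F (Matrix (Fin n) (Fin n) F)}

/-- The congruence by `P` as an endomorphism of an admissible space. -/
def Admissible.endo (hU : Admissible U) (P : Matrix (Fin n) (Fin n) F) : U →ₗ[F] U :=
  (congr P).restrict (hU.congr_mem P)

/-- The row vectors orthogonal to all `x i` and `w i`. -/
def orth {t : ℕ} (x w : Fin t → Fin n → F) : Submodule F (Fin n → F) :=
  LinearMap.ker (Matrix.mulVecLin (Matrix.of (Sum.elim x w)))

theorem mulVecLin_surjective {ι : Type*} [Fintype ι] (u : ι → Fin n → F)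
    (hu : LinearIndependent F u) :
    Function.Surjective (Matrix.mulVecLin (Matrix.of u)) := by
  have := LinearIndependent.rank_matrix (M := Matrix.of u) hu
  rw [Matrix.rank] at this
  rw [← LinearMap.range_eq_top]
  apply Submodule.eq_top_of_finrank_eq
  rw [this, finrank_fintype_fun_eq_card]

theorem card_pi_orth [Finite F] {t : ℕ} (x w : Fin t → Fin n → F)
    (h : LinearIndependent F (Sum.elim x w)) :
    Nat.card (Fin t → orth x w) = Nat.card F ^ (t * (n - 2 * t)) := by
  have h1 := (Matrix.mulVecLin (Matrix.of (Sum.elim x w))).finrank_range_add_finrank_ker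
  rw [LinearMap.range_eq_top.2 (mulVecLin_surjective _ h), finrank_top,
    finrank_fintype_fun_eq_card, finrank_fin_fun, Fintype.card_sum, Fintype.card_fin] at h1
  rw [Nat.card_fun, Module.natCard_eq_pow_finrank (K := F), orth, Nat.card_fin, ← pow_mul,
    show finrank F (LinearMap.ker (Matrix.mulVecLin (Matrix.of (Sum.elim x w)))) = n - 2 * t by
      omega, mul_comm]

/-- Matrices in `U` with prescribed rows in the directions `x i`, and zero in the directions
`w i`. -/
theorem Admissible.exists_prescribed (hU : Admissible U) {t : ℕ} (x w : Fin t → Fin n → F)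
    (h : LinearIndependent F (Sum.elim x w)) :
    ∃ L : (Fin t → orth x w) →ₗ[F] U, ∀ a j,
      x j ᵥ* (L a : Matrix (Fin n) (Fin n) F) = a j ∧
        w j ᵥ* (L a : Matrix (Fin n) (Fin n) F) = 0 := by
  obtain ⟨σ, hσ⟩ := hU.exists_sign
  have hdual : ∀ i : Fin t, ∃ v : Fin n → F,
      ∀ k, Sum.elim x w k ⬝ᵥ v = if k = Sum.inl i then 1 else 0 := by
    intro i
    obtain ⟨v, hv⟩ := mulVecLin_surjective _ h (fun k => if k = Sum.inl i then 1 else 0)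
    exact ⟨v, fun k => congrFun hv k⟩
  choose ξ hξ using hdual
  have horth : ∀ (b : orth x w) k, Sum.elim x w k ⬝ᵥ (b : Fin n → F) = 0 := fun b k =>
    congrFun (LinearMap.mem_ker.1 b.2) k
  -- Take a ↦ Σ (ξ_i a_iᵀ + σ a_i ξ_iᵀ), with ξ_i dual to x_i and vanishing on the other x and w.
  -- The a_i are orthogonal to every x and w, so the σ-terms do not affect the prescribed rows.
  refine ⟨{
    toFun := fun a => ⟨∑ i, (Matrix.vecMulVec (ξ i) (a i) + σ • Matrix.vecMulVec (a i) (ξ i)),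
      U.sum_mem fun i _ => hσ _ _⟩
    map_add' := fun a b => Subtype.ext (by
      simp only [Pi.add_apply, Submodule.coe_add, Matrix.vecMulVec_add, Matrix.add_vecMulVec,
        smul_add, ← Finset.sum_add_distrib]
      exact Finset.sum_congr rfl fun i _ => by abel)
    map_smul' := fun c a => Subtype.ext (by
      simp only [Pi.smul_apply, Submodule.coe_smul, Matrix.vecMulVec_smul, Matrix.smul_vecMulVec,
        RingHom.id_apply, Finset.smul_sum, smul_add, smul_comm σ c]) }, fun a j => ?_⟩
  have hrow : ∀ k, Sum.elim x w k ᵥ*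
      (∑ i, (Matrix.vecMulVec (ξ i) (a i) + σ • Matrix.vecMulVec (a i) (ξ i))) =
        ∑ i, (if k = Sum.inl i then (a i : Fin n → F) else 0) := by
    intro k
    rw [Matrix.vecMul_sum]
    refine Finset.sum_congr rfl fun i _ => ?_
    rw [Matrix.vecMul_add, Matrix.vecMul_smul, Matrix.vecMul_vecMulVec, Matrix.vecMul_vecMulVec,
      hξ, horth]
    simp
  constructor
  · refine (hrow (Sum.inl j)).trans ?_
    simp
  · refine (hrow (Sum.inr j)).trans ?_
    simp

/-- The span of a jointly independent family bounds the eigenspaces of a congruence. -/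
theorem Admissible.card_eigenspace_mul_le [Finite F] (hU : Admissible U)
    (P : GL (Fin n) F) {t : ℕ} (x : Fin t → Fin n → F)
    (hx : JointlyIndep (Matrix.mulVecLin (P : Matrix (Fin n) (Fin n) F)) x) (c : F) :
    Nat.card (LinearMap.ker (hU.endo P - c • LinearMap.id)) * Nat.card F ^ (t * (n - 2 * t)) ≤
      Nat.card U := by
  set w : Fin t → Fin n → F := fun i => (P : Matrix (Fin n) (Fin n) F) *ᵥ x i
  have hli : LinearIndependent F (Sum.elim x w) := by
    rw [Fintype.linearIndependent_iff]
    intro g hg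
    rw [Fintype.sum_sum_type] at hg
    have := hx (fun i => g (Sum.inl i)) (fun i => g (Sum.inr i)) hg
    rintro (i | i)
    · exact congrFun this.1 i
    · exact congrFun this.2 i
  obtain ⟨L, hL⟩ := hU.exists_prescribed x w hli
  -- If PᵀAP = cA with A = L a, the row of x_j gives c·a_j = (w_jᵀA)P = 0. For c = 0 invertibility
  -- of P kills A instead. So L has an image of full size that meets the eigenspace trivially.
  have hinj : ∀ a, L a ∈ LinearMap.ker (hU.endo P - c • LinearMap.id) → a = 0 := by
    intro a ha
    have h1 : (P : Matrix (Fin n) (Fin n) F)ᵀ * (L a : Matrix (Fin n) (Fin n) F) * P =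
        c • (L a : Matrix (Fin n) (Fin n) F) := by
      have := congrArg Subtype.val (sub_eq_zero.1 (LinearMap.mem_ker.1 ha))
      exact this
    refine funext fun j => Subtype.ext ?_
    rcases eq_or_ne c 0 with rfl | hc
    · have hP : (P : Matrix (Fin n) (Fin n) F) * (P⁻¹ : GL (Fin n) F) = 1 := by
        rw [← Units.val_mul, mul_inv_cancel, Units.val_one]
      have h2 : (L a : Matrix (Fin n) (Fin n) F) = 0 := by
        set B : Matrix (Fin n) (Fin n) F := (L a).1
        set G : Matrix (Fin n) (Fin n) F := P.1
        set Q : Matrix (Fin n) (Fin n) F := (P⁻¹ : GL (Fin n) F).1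
        calc B = (G * Q)ᵀ * B * (G * Q) := by rw [hP]; simp
          _ = Qᵀ * (Gᵀ * B * G) * Q := by
            simp only [Matrix.transpose_mul, Matrix.mul_assoc]
          _ = 0 := by rw [h1]; simp
      rw [← (hL a j).1, h2, Matrix.vecMul_zero]
      rfl
    · have h2 := congrArg (x j ᵥ* ·) h1
      simp only [← Matrix.vecMul_vecMul, Matrix.vecMul_transpose, Matrix.vecMul_smul] at h2
      rw [(hL a j).1, show (P : Matrix (Fin n) (Fin n) F) *ᵥ x j = w j from rfl, (hL a j).2,
        Matrix.zero_vecMul] at h2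
      exact (smul_eq_zero.1 h2.symm).resolve_left hc
  rw [← card_pi_orth x w hli, ← Nat.card_prod]
  refine Nat.card_le_card_of_injective (fun p => (p.1 : U) + L p.2) ?_
  intro p p' h
  have h' : (p.1 : U) + L p.2 = p'.1 + L p'.2 := h
  have h2 : p.2 = p'.2 := by
    rw [← sub_eq_zero]
    apply hinj
    rw [map_sub, show L p.2 - L p'.2 = (p'.1 : U) - p.1 by
      rw [sub_eq_sub_iff_add_eq_add, add_comm, h', add_comm]]
    exact Submodule.sub_mem _ p'.1.2 p.1.2
  rw [h2] at h'
  exact Prod.ext (Subtype.ext (add_right_cancel h')) h2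

theorem Admissible.pow_le_card [Finite F] (hU : Admissible U) {t : ℕ} (ht : 2 * t ≤ n) :
    Nat.card F ^ (t * (n - 2 * t)) ≤ Nat.card U := by
  obtain ⟨u, hu⟩ := exists_linearIndependent_of_le_finrank (R := F) (M := Fin n → F)
    (n := t + t) (by simp; omega)
  have hli := hu.comp _ (finSumFinEquiv (m := t) (n := t)).injective
  set x : Fin t → Fin n → F := fun i => u (finSumFinEquiv (Sum.inl i))
  set w : Fin t → Fin n → F := fun i => u (finSumFinEquiv (Sum.inr i))
  have hli' : LinearIndependent F (Sum.elim x w) := by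
    convert hli using 1
    ext (i | i) <;> rfl
  obtain ⟨L, hL⟩ := hU.exists_prescribed x w hli'
  rw [← card_pi_orth x w hli']
  refine Nat.card_le_card_of_injective L fun a b hab => ?_
  refine funext fun j => Subtype.ext ?_
  rw [← (hL a j).1, hab, (hL b j).1]

theorem exists_jointlyIndep_of_not_scalar (P : Matrix (Fin n) (Fin n) F)
    (hP : ∀ c : F, P ≠ c • 1) :
    ∃ x : Fin 1 → Fin n → F, JointlyIndep P.mulVecLin x := by
  by_contra! h
  obtain ⟨c, hc⟩ := LinearMap.exists_eq_smul_id_of_forall_notLinearIndependent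
    (f := P.mulVecLin) (fun v hv => h (fun _ => v) fun a b hab => by
      rw [Fin.sum_univ_one, Fin.sum_univ_one] at hab
      obtain ⟨ha, hb⟩ := LinearIndependent.pair_iff.1 hv _ _ hab
      constructor <;> ext i <;> rw [Subsingleton.elim i 0] <;> assumption)
  refine hP c (Matrix.mulVec_injective (funext fun v => ?_))
  rw [Matrix.smul_mulVec, Matrix.one_mulVec]
  exact LinearMap.congr_fun hc v

/-- A matrix is a scalar plus a matrix of small rank, or admits a long jointly independent
family. -/
theorem exists_jointlyIndep_or_eq_smul_one_add (P : Matrix (Fin n) (Fin n) F) {t : ℕ}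
    (ht : 2 * t ≤ n) :
    (∃ x : Fin t → Fin n → F, JointlyIndep P.mulVecLin x) ∨
      ∃ (c : F) (X : Matrix (Fin n) (Fin (2 * t)) F) (Y : Matrix (Fin (2 * t)) (Fin n) F),
        P = c • 1 + X * Y := by
  refine (exists_jointlyIndep_or P.mulVecLin t (by simpa using ht)).imp_right ?_
  rintro ⟨c, W, hW, h⟩
  obtain ⟨z, hz⟩ := exists_sup_span_range_eq (2 * t) ⊥ W bot_le (by simpa using hW)
  rw [bot_sup_eq] at hz
  have h' : ∀ j, ∃ y : Fin (2 * t) → F,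
      ∑ k, y k • z k = P.mulVecLin (Pi.single j 1) - c • Pi.single j 1 := by
    intro j
    refine (Submodule.mem_span_range_iff_exists_fun F).1 ?_
    rw [hz]
    exact h _
  choose y hy using h'
  -- The columns of X span W, and Y holds the coordinates of the columns of P − c in them.
  refine ⟨c, Matrix.of fun i k => z k i, Matrix.of fun k j => y j k, ?_⟩
  ext i j
  have := congrFun (hy j) i
  simp only [Finset.sum_apply, Pi.smul_apply, smul_eq_mul, Matrix.mulVecLin_apply,
    Matrix.mulVec_single_one, Pi.sub_apply, Matrix.col_apply] at this
  rw [Matrix.add_apply, Matrix.mul_apply, Matrix.smul_apply, Matrix.one_apply]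
  simp only [Matrix.of_apply, smul_eq_mul, mul_comm (z _ i)]
  rw [this, Pi.single_apply]
  ring

/-- For P = c + XY, PᵀAP − c²A = Yᵀ(XᵀAP) + (cAX)Y, which is determined by an r × n and an n × r
matrix. -/
theorem Admissible.card_range_endo_sub_le [Finite F] (hU : Admissible U) {r : ℕ} (c : F)
    (X : Matrix (Fin n) (Fin r) F) (Y : Matrix (Fin r) (Fin n) F) :
    Nat.card (LinearMap.range (hU.endo (c • 1 + X * Y) - (c ^ 2) • LinearMap.id)) ≤
      Nat.card F ^ (2 * r * n) := by
  let f : Matrix (Fin r) (Fin n) F × Matrix (Fin n) (Fin r) F → Matrix (Fin n) (Fin n) F :=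
    fun p => Yᵀ * p.1 + p.2 * Y
  have h : ∀ v : LinearMap.range (hU.endo (c • 1 + X * Y) - (c ^ 2) • LinearMap.id),
      ((v : U) : Matrix (Fin n) (Fin n) F) ∈ Set.range f := by
    rintro ⟨_, A, rfl⟩
    refine ⟨(Xᵀ * A.1 * (c • 1 + X * Y), c • (A.1 * X)), ?_⟩
    change Yᵀ * (Xᵀ * A.1 * (c • 1 + X * Y)) + c • (A.1 * X) * Y =
      (c • 1 + X * Y)ᵀ * A.1 * (c • 1 + X * Y) - c ^ 2 • A.1
    simp only [Matrix.transpose_add, Matrix.transpose_smul, Matrix.transpose_one,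
      Matrix.transpose_mul, Matrix.add_mul, Matrix.mul_add, Matrix.smul_mul, Matrix.mul_smul,
      Matrix.one_mul, Matrix.mul_one, Matrix.mul_assoc, smul_add, smul_smul, sq]
    abel
  have hinj : Function.Injective (fun v => (⟨_, h v⟩ : Set.range f)) := by
    intro v v' hv
    have hv' := congrArg Subtype.val hv
    exact Subtype.ext (Subtype.ext hv')
  calc _ ≤ Nat.card (Set.range f) := Nat.card_le_card_of_injective _ hinj
    _ ≤ _ := Finite.card_range_le f
    _ = _ := by
      rw [Nat.card_prod]
      simp only [Matrix, Nat.card_fun, Nat.card_fin, ← pow_mul, ← pow_add]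
      congr 1
      ring

end Congruence

/-! ### The union bound over nonscalar P -/

theorem ncard_iUnion_mul_le {α ι : Type*} [Finite ι] (S : ι → Set α) (M B : ℕ)
    (h : ∀ i, (S i).ncard * M ≤ B) : (⋃ i, S i).ncard * M ≤ Nat.card ι * B := by
  have := Fintype.ofFinite ι
  calc _ ≤ (∑ i, (S i).ncard) * M := Nat.mul_le_mul_right _ (Set.ncard_iUnion_le_of_fintype _)
    _ = ∑ i, (S i).ncard * M := Finset.sum_mul _ _ _
    _ ≤ ∑ _i : ι, B := Finset.sum_le_sum fun i _ => h i
    _ = _ := by simp [Nat.card_eq_fintype_card]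

theorem card_GL_le (F : Type*) [Field F] [Finite F] (n : ℕ) :
    Nat.card (GL (Fin n) F) ≤ Nat.card F ^ (n ^ 2) := by
  refine (Nat.card_le_card_of_injective _ (Units.val_injective (α := Matrix _ _ F))).trans ?_
  simp only [Matrix, Nat.card_fun, Nat.card_fin, ← pow_mul, sq, le_refl]

section Union

variable {F : Type*} [Field F] {n : ℕ} {U : Submodule F (Matrix (Fin n) (Fin n) F)}

/-- The `m`-dimensional subspaces of `U` invariant under the congruence by `P`. -/
def invariantSubspaces (hU : Admissible U) (m : ℕ) (P : Matrix (Fin n) (Fin n) F) :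
    Set (Submodule F U) :=
  {A | finrank F A = m ∧ A ≤ A.comap (hU.endo P)}

theorem ncard_invariantSubspaces_mul_le_of_smul_one_add [Finite F] (hU : Admissible U) {m r e : ℕ}
    (P : GL (Fin n) F) (hP : ∀ c : F, (P : Matrix (Fin n) (Fin n) F) ≠ c • 1) (c : F)
    (X : Matrix (Fin n) (Fin r) F) (Y : Matrix (Fin r) (Fin n) F)
    (hXY : (P : Matrix (Fin n) (Fin n) F) = c • 1 + X * Y)
    (h1 : e ≤ m * (n - 2)) (h2 : e + m + 2 * r * n ≤ finrank F U) :
    (invariantSubspaces hU m P).ncard * (frames F m * Nat.card F ^ e) ≤ 2 * Nat.card U ^ m := by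
  set T := hU.endo (P : Matrix (Fin n) (Fin n) F)
  set D := T - (c ^ 2) • LinearMap.id
  have hq : 0 < Nat.card F := Nat.card_pos
  obtain ⟨x, hx⟩ := exists_jointlyIndep_of_not_scalar _ hP
  have hE := hU.card_eigenspace_mul_le P x hx (c ^ 2)
  have hR : Nat.card (LinearMap.range D) ≤ Nat.card F ^ (2 * r * n) := by
    have := hU.card_range_endo_sub_le c X Y
    rwa [← hXY] at this
  let S₁ : Set (Submodule F U) := {A | finrank F A = m ∧ A ≤ LinearMap.ker D}
  let S₂ : {v : LinearMap.range D // (v : U) ≠ 0} → Set (Submodule F U) :=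
    fun v => {A | finrank F A = m ∧ (v.1 : U) ∈ A}
  -- If some v in A has Dv ≠ 0, then Dv = Tv − c²v is a nonzero vector of A in the range of D.
  have hsub : invariantSubspaces hU m P ⊆ S₁ ∪ ⋃ v, S₂ v := by
    rintro A ⟨hA, hT⟩
    by_cases hAD : A ≤ LinearMap.ker D
    · exact Or.inl ⟨hA, hAD⟩
    · obtain ⟨v, hvA, hv⟩ := SetLike.not_le_iff_exists.1 hAD
      exact Or.inr (Set.mem_iUnion.2 ⟨⟨⟨D v, v, rfl⟩, hv⟩, hA,
        A.sub_mem (hT hvA) (A.smul_mem _ hvA)⟩)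
  have hS₁ : S₁.ncard * (frames F m * Nat.card F ^ e) ≤ Nat.card U ^ m := by
    calc _ = S₁.ncard * frames F m * Nat.card F ^ e := by ring
      _ ≤ Nat.card (LinearMap.ker D) ^ m * Nat.card F ^ (m * (n - 2)) :=
        Nat.mul_le_mul (ncard_le_submodule_mul_frames_le _ m) (Nat.pow_le_pow_right hq h1)
      _ = (Nat.card (LinearMap.ker D) * Nat.card F ^ (1 * (n - 2 * 1))) ^ m := by
        rw [mul_pow, ← pow_mul]; ring_nf
      _ ≤ _ := Nat.pow_le_pow_left hE m
  have hS₂ : (⋃ v, S₂ v).ncard * (frames F m * Nat.card F ^ e) ≤ Nat.card U ^ m := by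
    have h3 : (⋃ v, S₂ v).ncard * (frames F m * Nat.card U) ≤
        Nat.card F ^ (2 * r * n) * (Nat.card F ^ m * Nat.card U ^ m) := by
      refine (ncard_iUnion_mul_le S₂ _ (Nat.card F ^ m * Nat.card U ^ m) fun v => ?_).trans
        (Nat.mul_le_mul_right _ ((Finite.card_subtype_le _).trans hR))
      rw [← mul_assoc]
      exact ncard_mem_mul_frames_le _ v.2 m
    have h4 : Nat.card F ^ (e + m + 2 * r * n) ≤ Nat.card U := by
      rw [Module.natCard_eq_pow_finrank (K := F) (V := U)]
      exact Nat.pow_le_pow_right hq h2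
    refine Nat.le_of_mul_le_mul_right (c := Nat.card F ^ (m + 2 * r * n)) ?_ (by positivity)
    calc _ = (⋃ v, S₂ v).ncard * (frames F m * Nat.card F ^ (e + m + 2 * r * n)) := by
          rw [add_assoc e, pow_add _ e]; ring
      _ ≤ (⋃ v, S₂ v).ncard * (frames F m * Nat.card U) := by gcongr
      _ ≤ _ := h3
      _ = _ := by rw [pow_add]; ring
  calc _ ≤ (S₁.ncard + (⋃ v, S₂ v).ncard) * (frames F m * Nat.card F ^ e) :=
        Nat.mul_le_mul_right _
          ((Set.ncard_le_ncard hsub (Set.toFinite _)).trans (Set.ncard_union_le _ _))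
    _ ≤ _ := by rw [add_mul]; omega

theorem ncard_invariantSubspaces_mul_le_of_jointlyIndep [Finite F] (hU : Admissible U)
    {m s t e : ℕ} (P : GL (Fin n) F) (x : Fin t → Fin n → F)
    (hx : JointlyIndep (P : Matrix (Fin n) (Fin n) F).mulVecLin x) (hs : 2 * s ≤ m)
    (h3 : e + m ^ 2 + 1 ≤ (m - 2 * s) * (t * (n - 2 * t))) (h4 : e + m ^ 2 ≤ finrank F U * s) :
    (invariantSubspaces hU m P).ncard * (frames F m * Nat.card F ^ e) ≤ 2 * Nat.card U ^ m := by
  have hq : 0 < Nat.card F := Nat.card_pos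
  have h := ncard_invariant_le (hU.endo (P : Matrix (Fin n) (Fin n) F)) hs
    (hU.card_eigenspace_mul_le P x hx)
  obtain ⟨r, hr⟩ := Nat.exists_eq_add_of_le h3
  have h5 : Nat.card U ^ (m - s) * Nat.card F ^ (e + m ^ 2) ≤ Nat.card U ^ m := by
    calc _ ≤ Nat.card U ^ (m - s) * Nat.card U ^ s := by
          refine Nat.mul_le_mul_left _ ?_
          rw [Module.natCard_eq_pow_finrank (K := F) (V := U), ← pow_mul]
          exact Nat.pow_le_pow_right hq h4
      _ = _ := by rw [← pow_add]; congr 1; omega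
  -- Here r is the slack in `h3`; the extra 1 there absorbs the q possible eigenvalues, and m²
  -- absorbs `frames F m`.
  refine Nat.le_of_mul_le_mul_right (c := Nat.card F ^ (r + 1)) ?_ (by positivity)
  calc _ ≤ (invariantSubspaces hU m P).ncard * (Nat.card F ^ (m ^ 2) * Nat.card F ^ e) *
        Nat.card F ^ (r + 1) := by
          gcongr
          exact frames_le F m
    _ = (invariantSubspaces hU m P).ncard * Nat.card F ^ ((m - 2 * s) * (t * (n - 2 * t))) := by
        rw [hr]; ring
    _ ≤ _ := h
    _ = Nat.card F * Nat.card U ^ m +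
        (Nat.card U ^ (m - s) * Nat.card F ^ (e + m ^ 2)) * Nat.card F ^ (r + 1) := by
        rw [hr]; ring
    _ ≤ Nat.card F ^ (r + 1) * Nat.card U ^ m + Nat.card U ^ m * Nat.card F ^ (r + 1) := by
        gcongr
        exact Nat.le_self_pow (by omega) _
    _ = _ := by ring

/-- The union bound over all congruences by nonscalar matrices. -/
theorem ncard_exists_invariant_mul_le [Finite F] (hU : Admissible U) {m s t h : ℕ}
    (hm : m ≤ finrank F U) (ht : 2 * t ≤ n) (hs : 2 * s ≤ m)
    (h1 : 3 + h + m + 4 * t * n ≤ m * (n - 2))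
    (h2 : 3 + h + 2 * m + 8 * t * n ≤ finrank F U)
    (h3 : 3 + h + m + n ^ 2 + m ^ 2 ≤ (m - 2 * s) * (t * (n - 2 * t)))
    (h4 : 2 + h + m + n ^ 2 + m ^ 2 ≤ finrank F U * s) :
    {A : Submodule F U | finrank F A = m ∧ ∃ P : GL (Fin n) F,
      (∀ c : F, (P : Matrix (Fin n) (Fin n) F) ≠ c • 1) ∧
        A ≤ A.comap (hU.endo (P : Matrix (Fin n) (Fin n) F))}.ncard * Nat.card F ^ h ≤
      {A : Submodule F U | finrank F A = m}.ncard := by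
  have hq : 1 < Nat.card F := Finite.one_lt_card
  -- Indexing by the factorization (c, X, Y) instead of P keeps the index set as small as q^(1 +
  -- 4tn).
  let S₁ : F × Matrix (Fin n) (Fin (2 * t)) F × Matrix (Fin (2 * t)) (Fin n) F →
      Set (Submodule F U) := fun p =>
    {A | ∃ P : GL (Fin n) F, (∀ c : F, (P : Matrix (Fin n) (Fin n) F) ≠ c • 1) ∧
      (P : Matrix (Fin n) (Fin n) F) = p.1 • 1 + p.2.1 * p.2.2 ∧ A ∈ invariantSubspaces hU m P}
  let S₂ : GL (Fin n) F → Set (Submodule F U) := fun P =>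
    {A | (∃ x : Fin t → Fin n → F, JointlyIndep (P : Matrix (Fin n) (Fin n) F).mulVecLin x) ∧
      A ∈ invariantSubspaces hU m P}
  have hS₁ := ncard_iUnion_mul_le S₁ (frames F m * Nat.card F ^ (3 + h + m + 4 * t * n))
    (2 * Nat.card U ^ m) fun p => by
      by_cases hp : ∃ P : GL (Fin n) F, (∀ c : F, (P : Matrix (Fin n) (Fin n) F) ≠ c • 1) ∧
          (P : Matrix (Fin n) (Fin n) F) = p.1 • 1 + p.2.1 * p.2.2
      · obtain ⟨P, hP, hPp⟩ := hp
        refine le_trans (Nat.mul_le_mul_right _ (Set.ncard_le_ncard ?_ (Set.toFinite _)))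
          (ncard_invariantSubspaces_mul_le_of_smul_one_add hU P hP p.1 p.2.1 p.2.2 hPp h1 ?_)
        · rintro A ⟨P', _, hP', hA⟩
          rwa [hPp, ← hP']
        · refine le_trans (le_of_eq ?_) h2
          ring
      · rw [show S₁ p = ∅ from Set.eq_empty_of_forall_notMem
          fun A ⟨P, hP, hPp, _⟩ => hp ⟨P, hP, hPp⟩]
        simp
  have hS₂ := ncard_iUnion_mul_le S₂ (frames F m * Nat.card F ^ (2 + h + m + n ^ 2))
    (2 * Nat.card U ^ m) fun P => by
      by_cases hP : ∃ x : Fin t → Fin n → F,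
          JointlyIndep (P : Matrix (Fin n) (Fin n) F).mulVecLin x
      · obtain ⟨x, hx⟩ := hP
        exact le_trans (Nat.mul_le_mul_right _ (Set.ncard_le_ncard (fun A hA => hA.2)
          (Set.toFinite _))) (ncard_invariantSubspaces_mul_le_of_jointlyIndep hU P x hx hs
            (by omega) (by omega))
      · rw [show S₂ P = ∅ from Set.eq_empty_of_forall_notMem fun A hA => hP hA.1]
        simp
  have hι₁ : Nat.card (F × Matrix (Fin n) (Fin (2 * t)) F × Matrix (Fin (2 * t)) (Fin n) F) =
      Nat.card F ^ (1 + 4 * t * n) := by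
    simp only [Nat.card_prod, Matrix, Nat.card_fun, Nat.card_fin]
    ring
  rw [hι₁] at hS₁
  set S := {A : Submodule F U | finrank F A = m ∧ ∃ P : GL (Fin n) F,
      (∀ c : F, (P : Matrix (Fin n) (Fin n) F) ≠ c • 1) ∧
        A ≤ A.comap (hU.endo (P : Matrix (Fin n) (Fin n) F))}
  have hsub : S ⊆ (⋃ p, S₁ p) ∪ ⋃ P, S₂ P := by
    rintro A ⟨hA, P, hP, hT⟩
    rcases exists_jointlyIndep_or_eq_smul_one_add (P : Matrix (Fin n) (Fin n) F) ht with
      hx | ⟨c, X, Y, hXY⟩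
    · exact Or.inr (Set.mem_iUnion.2 ⟨P, hx, hA, hT⟩)
    · exact Or.inl (Set.mem_iUnion.2 ⟨(c, X, Y), P, hP, hXY, hA, hT⟩)
  have hcard : S.ncard ≤ (⋃ p, S₁ p).ncard + (⋃ P, S₂ P).ncard :=
    (Set.ncard_le_ncard hsub (Set.toFinite _)).trans (Set.ncard_union_le _ _)
  have hb₁ : (⋃ p, S₁ p).ncard * (frames F m * Nat.card F ^ (2 + h + m)) ≤
      2 * Nat.card U ^ m := by
    refine Nat.le_of_mul_le_mul_left (c := Nat.card F ^ (1 + 4 * t * n)) ?_ (by positivity)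
    refine le_trans (le_of_eq ?_) hS₁
    ring
  have hb₂ : (⋃ P, S₂ P).ncard * (frames F m * Nat.card F ^ (2 + h + m)) ≤
      2 * Nat.card U ^ m := by
    refine Nat.le_of_mul_le_mul_left (c := Nat.card F ^ (n ^ 2)) ?_ (by positivity)
    refine le_trans (le_of_eq ?_) (hS₂.trans (Nat.mul_le_mul_right _ (card_GL_le F n)))
    ring
  have hb : S.ncard * (frames F m * Nat.card F ^ (2 + h + m)) ≤ 4 * Nat.card U ^ m := by
    have := Nat.mul_le_mul_right (frames F m * Nat.card F ^ (2 + h + m)) hcard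
    rw [add_mul] at this
    omega
  -- The factor q² absorbs the constant 4 = 2 + 2 of the two families.
  have hq2 : 4 ≤ Nat.card F ^ 2 := by nlinarith
  have htot := card_pow_le_mul_frames (F := F) (V := U) hm
  refine Nat.le_of_mul_le_mul_right (c := frames F m * Nat.card F ^ (2 + m)) ?_
    (Nat.mul_pos (frames_pos F m) (by positivity))
  calc _ = S.ncard * (frames F m * Nat.card F ^ (2 + h + m)) := by ring
    _ ≤ _ := hb
    _ ≤ Nat.card F ^ 2 * (Nat.card F ^ m *
        ({A : Submodule F U | finrank F A = m}.ncard * frames F m)) := Nat.mul_le_mul hq2 htot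
    _ = _ := by ring

end Union

/-! ### From invariant subspaces to automorphism groups -/

section Transfer

variable {F : Type*} [Field F] {n : ℕ} {U : Submodule F (Matrix (Fin n) (Fin n) F)}

theorem one_le_K [Finite F] (m : ℕ) : 1 ≤ K F m := by
  have h0 : 0 < Nat.card (GL (Fin m) F) := Nat.card_pos
  rw [K, one_le_div (by exact_mod_cast h0)]
  exact_mod_cast card_GL_le F m

theorem exists_nonscalar_mem_Aut [Finite F] (hn : 0 < n)
    (A : Submodule F (Matrix (Fin n) (Fin n) F))
    (hA : (Nat.card F : ℝ) - 1 < Nat.card (Aut A)) :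
    ∃ P ∈ Aut A, ∀ c : F, (P : Matrix (Fin n) (Fin n) F) ≠ c • 1 := by
  by_contra! h
  have : Nonempty (Fin n) := ⟨⟨0, hn⟩⟩
  choose c hc using fun P : Aut A => h P.1 P.2
  have hc0 : ∀ P, c P ≠ 0 := by
    intro P h0
    have := hc P
    rw [h0, zero_smul] at this
    exact P.1.ne_zero this
  have hle : Nat.card (Aut A) ≤ Nat.card Fˣ :=
    Nat.card_le_card_of_injective (fun P => Units.mk0 (c P) (hc0 P)) fun P P' hP => by
      have hP' : c P = c P' := congrArg Units.val hP
      refine Subtype.ext (Units.ext ?_)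
      rw [hc P, hc P', hP']
  rw [Nat.card_units] at hle
  have h1 : 1 ≤ Nat.card F := Nat.card_pos
  have h2 : (Nat.card (Aut A) : ℝ) ≤ (Nat.card F - 1 : ℕ) := by exact_mod_cast hle
  rw [Nat.cast_sub h1, Nat.cast_one] at h2
  linarith

theorem Gr_eq_image (U : Submodule F (Matrix (Fin n) (Fin n) F)) (m : ℕ) :
    Gr U m = Submodule.map U.subtype '' {A : Submodule F U | finrank F A = m} := by
  ext A
  constructor
  · rintro ⟨hA, hm⟩
    refine ⟨A.comap U.subtype, ?_, ?_⟩
    · exact (LinearEquiv.finrank_eq (Submodule.comapSubtypeEquivOfLe hA)).trans hm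
    · rw [Submodule.map_comap_subtype, inf_eq_right.2 hA]
  · rintro ⟨B, hB, rfl⟩
    exact ⟨Submodule.map_subtype_le U B, (Submodule.finrank_map_subtype_eq U B).trans hB⟩

theorem ncard_Gr (U : Submodule F (Matrix (Fin n) (Fin n) F)) (m : ℕ) :
    (Gr U m).ncard = {A : Submodule F U | finrank F A = m}.ncard := by
  rw [Gr_eq_image]
  exact Set.ncard_image_of_injective _ (Submodule.map_injective_of_injective U.injective_subtype)

/-- The constant K enters only through K ≥ 1: already more than q − 1 automorphisms force a
nonscalar one. -/
theorem exceptional_subset_image [Finite F] (hU : Admissible U) (hn : 0 < n) (m : ℕ) :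
    exceptional U m ⊆ Submodule.map U.subtype '' {A : Submodule F U | finrank F A = m ∧
      ∃ P : GL (Fin n) F, (∀ c : F, (P : Matrix (Fin n) (Fin n) F) ≠ c • 1) ∧
        A ≤ A.comap (hU.endo (P : Matrix (Fin n) (Fin n) F))} := by
  rintro A ⟨hA, hAut⟩
  rw [Gr_eq_image] at hA
  obtain ⟨B, hB, rfl⟩ := hA
  have hq : (1 : ℝ) ≤ Nat.card F := by
    exact_mod_cast (Nat.card_pos : 0 < Nat.card F)
  obtain ⟨P, hP, hsc⟩ := exists_nonscalar_mem_Aut hn _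
    (lt_of_le_of_lt (le_mul_of_one_le_left (sub_nonneg.2 hq) (one_le_K m)) hAut)
  refine ⟨B, ⟨hB, P, hsc, fun v hv => ?_⟩, rfl⟩
  have hP' : (B.map U.subtype).map (congr (P : Matrix (Fin n) (Fin n) F)) = B.map U.subtype := hP
  have : congr (P : Matrix (Fin n) (Fin n) F) v ∈ B.map U.subtype := by
    rw [← hP']
    exact Submodule.mem_map_of_mem (Submodule.mem_map_of_mem hv)
  obtain ⟨w, hw, hwv⟩ := this
  have hwe : hU.endo (P : Matrix (Fin n) (Fin n) F) v = w := Subtype.ext hwv.symm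
  rw [Submodule.mem_comap, hwe]
  exact hw

theorem Admissible.allButFraction [Finite F] (hU : Admissible U) {m s t h : ℕ} {δ : ℝ}
    (hn : 0 < n) (hδ : δ ≤ h)
    (hm : m ≤ finrank F U) (ht : 2 * t ≤ n) (hs : 2 * s ≤ m)
    (h1 : 3 + h + m + 4 * t * n ≤ m * (n - 2))
    (h2 : 3 + h + 2 * m + 8 * t * n ≤ finrank F U)
    (h3 : 3 + h + m + n ^ 2 + m ^ 2 ≤ (m - 2 * s) * (t * (n - 2 * t)))
    (h4 : 2 + h + m + n ^ 2 + m ^ 2 ≤ finrank F U * s) :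
    AllButFraction U m (1 / (Nat.card F : ℝ) ^ δ) := by
  have key := ncard_exists_invariant_mul_le hU hm ht hs h1 h2 h3 h4
  have hq : (1 : ℝ) ≤ Nat.card F := by
    exact_mod_cast (Nat.card_pos : 0 < Nat.card F)
  have hGr : 0 < (Gr U m).ncard := by
    rw [ncard_Gr]
    by_contra h0
    have := card_pow_le_mul_frames (F := F) hm
    rw [Nat.eq_zero_of_not_pos h0, zero_mul, mul_zero] at this
    have h5 : 0 < Nat.card U ^ m := pow_pos Nat.card_pos m
    omega
  refine ⟨Set.nonempty_of_ncard_ne_zero hGr.ne', ?_⟩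
  have hex : (exceptional U m).ncard * Nat.card F ^ h ≤ (Gr U m).ncard := by
    rw [ncard_Gr]
    exact (Nat.mul_le_mul_right _ ((Set.ncard_le_ncard (exceptional_subset_image hU hn m)
      (Set.toFinite _)).trans (Set.ncard_image_le (Set.toFinite _)))).trans key
  have hpow : (Nat.card F : ℝ) ^ δ ≤ (Nat.card F : ℝ) ^ h := by
    rw [← Real.rpow_natCast]
    exact Real.rpow_le_rpow_of_exponent_le hq hδ
  rw [div_le_div_iff₀ (by exact_mod_cast hGr) (by positivity), one_mul]
  calc _ ≤ ((exceptional U m).ncard : ℝ) * (Nat.card F : ℝ) ^ h := by gcongr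
    _ ≤ _ := by exact_mod_cast hex

/-- The choice t = n/4 makes t(n − 2t) largest, giving a quadratic lower bound for dim U common to
all three spaces. -/
theorem Admissible.le_finrank [Finite F] (hU : Admissible U) :
    n / 4 * (n - 2 * (n / 4)) ≤ finrank F U := by
  have h := hU.pow_le_card (t := n / 4) (by omega)
  rw [Module.natCard_eq_pow_finrank (K := F) (V := U)] at h
  exact (Nat.pow_le_pow_iff_right Finite.one_lt_card).1 h

end Transfer

/-- The choice of parameters for the union bound. -/
theorem exists_parameters (C R : ℚ) (hC : 0 < C) :
    ∃ ε : ℝ, 0 < ε ∧ ∃ t n₀ : ℕ, ∀ n m : ℕ, n₀ ≤ n → (m : ℤ) = ⌈C * (n : ℚ) + R⌉ →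
      ∃ h s : ℕ, ε * (n : ℝ) ^ 2 ≤ h ∧ 0 < n ∧ 2 * t ≤ n ∧ 2 * s ≤ m ∧
        3 + h + m + 4 * t * n ≤ m * (n - 2) ∧
        3 + h + m + n ^ 2 + m ^ 2 ≤ (m - 2 * s) * (t * (n - 2 * t)) ∧
        ∀ N : ℕ, n / 4 * (n - 2 * (n / 4)) ≤ N →
          m ≤ N ∧ 3 + h + 2 * m + 8 * t * n ≤ N ∧ 2 + h + m + n ^ 2 + m ^ 2 ≤ N * s := by
  -- For large n, c₁n ≤ m ≤ c₂n, whatever R is.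
  set c₁ : ℝ := C / 2 with hc₁
  set c₂ : ℝ := C + 1 with hc₂
  have hCr : (0 : ℝ) < C := by exact_mod_cast hC
  have hc₁0 : 0 < c₁ := by positivity
  have hc₂0 : 0 < c₂ := by positivity
  -- Half the leading coefficients of m(n − 2) ≥ c₁n(n − 2) and of the bound dim U ≥ n²/16; the
  -- other halves absorb the linear terms.
  set ε : ℝ := min (c₁ / 2) (1 / 32)
  have hε : 0 < ε := by positivity
  have hε₁ : ε ≤ c₁ / 2 := min_le_left _ _
  have hε₂ : ε ≤ 1 / 32 := min_le_right _ _
  -- With m − 2s ≥ m/2 and n − 2t ≥ n/2, the product in `h3` is at least c₁tn²/4, which must exceed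
  -- (ε + 1 + c₂²)n² with n² to spare for lower terms.
  obtain ⟨t, ht⟩ := exists_nat_ge (4 * (ε + 2 + c₂ ^ 2) / c₁)
  have ht' : ε + 2 + c₂ ^ 2 ≤ c₁ * t / 4 := by
    rw [div_le_iff₀ hc₁0] at ht
    linarith
  have ev : ∀ a c : ℝ, 0 < c → ∀ᶠ n : ℕ in Filter.atTop, a ≤ c * n := fun a c hc =>
    (tendsto_natCast_atTop_atTop.const_mul_atTop hc).eventually_ge_atTop a
  obtain ⟨n₀, hn₀⟩ := Filter.eventually_atTop.1 <|
    (ev 8 1 one_pos).and <| (ev (-R) c₁ hc₁0).and <| (ev (R + 1) 1 one_pos).and <|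
    (ev (32 * t) 1 one_pos).and <| (ev (4 + c₂ + 4 * t + 2 * c₁) (c₁ / 2) (by positivity)).and <|
    (ev (4 + 2 * c₂ + 8 * t) (1 / 32) (by positivity)).and <|
    (ev (4 + c₂) 1 one_pos).and (ev 1 (c₁ / 8) (by positivity))
  refine ⟨ε, hε, t, n₀, fun n m hn hm => ?_⟩
  obtain ⟨e1, e2, e3, e4, e5, e6, e7, e8⟩ := hn₀ n hn
  rw [one_mul] at e1 e3 e4 e7
  have hm₁ : c₁ * n ≤ m := by
    have h := Int.le_ceil (C * (n : ℚ) + R)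
    rw [← hm] at h
    have h' : (C : ℝ) * n + R ≤ m := by exact_mod_cast h
    rw [hc₁] at e2 ⊢
    linarith
  have hm₂ : m ≤ c₂ * n := by
    have h := Int.ceil_lt_add_one (C * (n : ℚ) + R)
    rw [← hm] at h
    have h' : (m : ℝ) < C * n + R + 1 := by exact_mod_cast h
    rw [hc₂]
    linarith
  have hn8 : 8 ≤ n := by exact_mod_cast e1
  have hnt : 32 * t ≤ n := by exact_mod_cast e4
  set h := ⌈ε * (n : ℝ) ^ 2⌉₊
  have hh : (h : ℝ) ≤ ε * (n : ℝ) ^ 2 + 1 := (Nat.ceil_lt_add_one (by positivity)).le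
  have hn0 : (0 : ℝ) ≤ n := by positivity
  have hm0 : (0 : ℝ) ≤ m := by positivity
  have hmm : (m : ℝ) ^ 2 ≤ c₂ ^ 2 * (n : ℝ) ^ 2 := by
    rw [← mul_pow]
    exact pow_le_pow_left₀ hm0 hm₂ 2
  have hbig : 4 + h + (m : ℝ) + (n : ℝ) ^ 2 + (m : ℝ) ^ 2 ≤ c₁ * t / 4 * (n : ℝ) ^ 2 + 1 := by
    have h5 := mul_le_mul_of_nonneg_right ht' (sq_nonneg (n : ℝ))
    have h6 := mul_le_mul_of_nonneg_right e7 hn0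
    nlinarith
  refine ⟨h, m / 4, Nat.le_ceil _, by omega, by omega, by omega, ?_, ?_, fun N hN => ?_⟩
  · have h2 : 2 ≤ n := by omega
    rw [← Nat.cast_le (α := ℝ)]
    push_cast [Nat.cast_sub h2]
    have h5 := mul_le_mul_of_nonneg_right e5 hn0
    have h6 := mul_le_mul_of_nonneg_right hε₁ (sq_nonneg (n : ℝ))
    have h7 : c₁ * n * (n - 2) ≤ m * ((n : ℝ) - 2) :=
      mul_le_mul_of_nonneg_right hm₁ (by linarith)
    nlinarith
  · have h4 : (m : ℝ) / 2 ≤ (m - 2 * (m / 4) : ℕ) := by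
      have : m ≤ 2 * (m - 2 * (m / 4)) := by omega
      have : (m : ℝ) ≤ 2 * (m - 2 * (m / 4) : ℕ) := by exact_mod_cast this
      linarith
    have h5 : (n : ℝ) / 2 ≤ (n - 2 * t : ℕ) := by
      have : n ≤ 2 * (n - 2 * t) := by omega
      have : (n : ℝ) ≤ 2 * (n - 2 * t : ℕ) := by exact_mod_cast this
      linarith
    rw [← Nat.cast_le (α := ℝ), Nat.cast_mul, Nat.cast_mul]
    calc _ ≤ c₁ * t / 4 * (n : ℝ) ^ 2 := by push_cast; linarith
      _ = (c₁ * n / 2) * (t * (n / 2)) := by ring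
      _ ≤ _ := by gcongr; linarith
  · have hNr : (n : ℝ) ^ 2 / 16 ≤ N := by
      have h4 : n ≤ 8 * (n / 4) := by omega
      have h5 : n ≤ 2 * (n - 2 * (n / 4)) := by omega
      have h6 : n * n ≤ 16 * N := by
        calc n * n ≤ (8 * (n / 4)) * (2 * (n - 2 * (n / 4))) := Nat.mul_le_mul h4 h5
          _ = 16 * (n / 4 * (n - 2 * (n / 4))) := by ring
          _ ≤ _ := Nat.mul_le_mul_left _ hN
      have h7 : (n : ℝ) * n ≤ 16 * N := by exact_mod_cast h6
      linarith [sq (n : ℝ)]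
    have hlin : 3 + h + 2 * m + 8 * t * n ≤ N := by
      rw [← Nat.cast_le (α := ℝ)]
      push_cast
      have h5 := mul_le_mul_of_nonneg_right e6 hn0
      have h6 := mul_le_mul_of_nonneg_right hε₂ (sq_nonneg (n : ℝ))
      nlinarith
    refine ⟨by omega, hlin, ?_⟩
    have hs : c₁ * n / 8 ≤ (m / 4 : ℕ) := by
      have : m ≤ 4 * (m / 4) + 4 := by omega
      have : (m : ℝ) ≤ 4 * (m / 4 : ℕ) + 4 := by exact_mod_cast this
      linarith
    rw [← Nat.cast_le (α := ℝ), Nat.cast_mul]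
    -- The product of dim U and s is cubic in n, so it exceeds c₁tn²/4 once n ≥ 32t.
    calc _ ≤ c₁ * (n : ℝ) ^ 2 / 128 * (32 * t) := by push_cast; linarith
      _ ≤ c₁ * (n : ℝ) ^ 2 / 128 * n := by gcongr
      _ = (n : ℝ) ^ 2 / 16 * (c₁ * n / 8) := by ring
      _ ≤ _ := by gcongr

end MatSpace

theorem mainTheorem4 (C R : ℚ) (hC : 0 < C) :
    ∃ ε : ℝ, 0 < ε ∧ ∃ n₀ : ℕ,
      ∀ (F : Type*) [Field F] [Finite F] (n m : ℕ), n₀ ≤ n → (m : ℤ) = ⌈C * (n : ℚ) + R⌉ →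
        MatSpace.AllButFraction (MatSpace.alternating F n) m
            (1 / (Nat.card F : ℝ) ^ (ε * (n : ℝ) ^ 2)) ∧
        MatSpace.AllButFraction (MatSpace.general F n) m
            (1 / (Nat.card F : ℝ) ^ (ε * (n : ℝ) ^ 2)) ∧
        MatSpace.AllButFraction (MatSpace.symmetric F n) m
            (1 / (Nat.card F : ℝ) ^ (ε * (n : ℝ) ^ 2)) := by
  obtain ⟨ε, hε, t, n₀, H⟩ := MatSpace.exists_parameters C R hC
  refine ⟨ε, hε, n₀, fun F _ _ n m hn hm => ?_⟩
  obtain ⟨h, s, hh, hn0, ht, hs, h1, h3, HN⟩ := H n m hn hm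
  have key : ∀ U : Submodule F (Matrix (Fin n) (Fin n) F), MatSpace.Admissible U →
      MatSpace.AllButFraction U m (1 / (Nat.card F : ℝ) ^ (ε * (n : ℝ) ^ 2)) := by
    intro U hU
    obtain ⟨hm, h2, h4⟩ := HN _ hU.le_finrank
    exact hU.allButFraction hn0 hh hm ht hs h1 h2 h3 h4
  exact ⟨key _ MatSpace.admissible_alternating, key _ MatSpace.admissible_general,
    key _ MatSpace.admissible_symmetric⟩
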